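/- All graphs are finite and simple. A graph $G$ is $k$-extendable if it has a perfect matching and every matching of $G$ consisting of exactly $k$ edges is contained in a perfect matching of $G$. For integers $n,k\ge 0$, $G$ is an $(n,k)$-graph if $|G|\ge n+2k+2$, $|G|\equiv n \pmod 2$, and for every set $S$ of $n$ vertices of $G$ the graph $G-S$ is $k$-extendable. An embedding of $G$ on a closed surface $\Sigma$ is a (tame) drawing of $G$ on $\Sigma$ without crossings that is cellular: every face, i.e. every connected component of the complement of the drawing, is homeomorphic to an open disk. A face is triangular if its boundary walk has length $3$. Lemma. Let $n\ge 0$ and $k\ge 1$. Let $G$ be a connected $(n,k)$-graph embedded on a closed surface $\Sigma$, and let $v$ be a vertex of $G$ that is contained in (the boundary of) exactly $x$ triangular faces. Then the degree $d(v)$ of $v$ satisfies \[ d(v)\ \ge\ \begin{cases} n+k+1+\lceil x/2\rceil, & \text{if } x\le 2k-2,\\ n+2k+1, & \text{if } x\ge 2k-1.\end{cases} \] -/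

import Mathlib

/-- `G` is `k`-extendable: it has a perfect matching, and every matching with exactly `k` edges
is contained in a perfect matching. -/
def SimpleGraph.IsExtendable {V : Type*} (G : SimpleGraph V) (k : ℕ) : Prop :=
  (∃ P : G.Subgraph, P.IsPerfectMatching) ∧
    ∀ M : G.Subgraph, M.IsMatching → M.edgeSet.ncard = k →
      ∃ P : G.Subgraph, P.IsPerfectMatching ∧ M ≤ P

/-- `G` is an `(n, k)`-graph: `|G| ≥ n + 2k + 2`, `|G| ≡ n (mod 2)`, and deleting any `n` vertices
leaves a `k`-extendable graph. -/
def SimpleGraph.IsNKGraph {V : Type*} [Fintype V] (G : SimpleGraph V) (n k : ℕ) : Prop :=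
  n + 2 * k + 2 ≤ Fintype.card V ∧ Fintype.card V ≡ n [MOD 2] ∧
    ∀ S : Finset V, S.card = n → (G.induce ((S : Set V)ᶜ)).IsExtendable k

/-- A drawing of the simple graph `G` on the space `X` without crossings: vertices are distinct
points, every edge is a simple arc joining its two ends, an arc passes through no vertex other than
its ends, and arcs of different edges can meet in (images of) vertices only. -/
structure GraphDrawing {V : Type*} (G : SimpleGraph V) (X : Type*) [TopologicalSpace X] where
  /-- the point representing a vertex -/
  vert : V → X
  /-- the arc representing an edge, traversed from `u` to `v` -/
  arc : ∀ {u v : V}, G.Adj u v → Path (vert u) (vert v)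
  vert_injective : Function.Injective vert
  arc_symm : ∀ {u v : V} (h : G.Adj u v), arc h.symm = (arc h).symm
  arc_injective : ∀ {u v : V} (h : G.Adj u v), Function.Injective (arc h)
  vert_mem_arc : ∀ {u v : V} (h : G.Adj u v) (w : V),
    vert w ∈ Set.range (arc h) → w = u ∨ w = v
  arc_inter_arc : ∀ {u v u' v' : V} (h : G.Adj u v) (h' : G.Adj u' v'), s(u, v) ≠ s(u', v') →
    Set.range (arc h) ∩ Set.range (arc h') ⊆ Set.range vert

namespace GraphDrawing

variable {V : Type*} {G : SimpleGraph V} {X : Type*} [TopologicalSpace X]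

/-- The image of the graph: the union of all vertex points and all arcs. -/
def image (D : GraphDrawing G X) : Set X :=
  Set.range D.vert ∪ {p | ∃ (u v : V) (h : G.Adj u v), p ∈ Set.range (D.arc h)}

/-- The faces are the connected components of the complement of the graph. -/
def IsFace (D : GraphDrawing G X) (F : Set X) : Prop :=
  ∃ p ∈ D.imageᶜ, F = connectedComponentIn D.imageᶜ p

/-- Around every vertex `v` there is a disk neighbourhood with coordinates in the open unit disk of
`ℂ`, centred at `v`, in which the drawing is a star: the edges at `v` become distinct radii and
nothing else of the graph is present. -/
def IsTame (D : GraphDrawing G X) : Prop :=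
  ∀ v : V, ∃ (e : OpenPartialHomeomorph X ℂ) (a : G.neighborSet v → ℂ),
    D.vert v ∈ e.source ∧ e (D.vert v) = 0 ∧ e.target = Metric.ball 0 1 ∧
    Function.Injective a ∧ (∀ u, ‖a u‖ = 1) ∧
    (∀ u : G.neighborSet v, ∀ p ∈ e.source,
      p ∈ Set.range (D.arc ((G.mem_neighborSet v u).1 u.2)) ↔
        ∃ t : ℝ, 0 ≤ t ∧ e p = (t : ℂ) * a u) ∧
    (∀ p ∈ e.source, p ∈ D.image →
      p = D.vert v ∨
        ∃ u : G.neighborSet v, p ∈ Set.range (D.arc ((G.mem_neighborSet v u).1 u.2)))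

/-- Every face is homeomorphic to an open disk. -/
def IsCellular (D : GraphDrawing G X) : Prop :=
  ∀ F : Set X, D.IsFace F → Nonempty (F ≃ₜ Metric.ball (0 : ℂ) 1)

/-- The closed walk `w` is a boundary walk of `F`: some continuous map of the closed unit disk
restricts to a homeomorphism of the open disk onto `F`, while the unit circle, divided into
`w.length` equal parts, runs along the successive edges of `w`. -/
def IsBoundaryWalk (D : GraphDrawing G X) (F : Set X) {u : V} (w : G.Walk u u) : Prop :=
  ∃ φ : ℂ → X, ContinuousOn φ (Metric.closedBall 0 1) ∧
    (∃ h : Metric.ball (0 : ℂ) 1 ≃ₜ F, ∀ z : Metric.ball (0 : ℂ) 1, φ z = h z) ∧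
    ∀ (i : ℕ) (hi : i < w.length) (t : unitInterval),
      φ (Complex.exp (2 * Real.pi * Complex.I * ((i + (t : ℝ)) / w.length))) =
        D.arc (w.adj_getVert_succ hi) t

/-- A triangular face: a face with boundary walk of length `3`. -/
def IsTriangularFace (D : GraphDrawing G X) (F : Set X) : Prop :=
  D.IsFace F ∧ ∃ (u : V) (w : G.Walk u u), w.length = 3 ∧ D.IsBoundaryWalk F w

/-- The set of triangular faces that contain the vertex `v` (on their boundary). -/
def triangularFacesAt (D : GraphDrawing G X) (v : V) : Set (Set X) :=
  {F | D.IsTriangularFace F ∧ D.vert v ∈ closure F}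

end GraphDrawing

/-- A (tame) cellular embedding of the graph `G` on the surface `X`. -/
structure CellularEmbedding {V : Type*} (G : SimpleGraph V) (X : Type*) [TopologicalSpace X]
    extends GraphDrawing G X where
  /-- In dimension two this holds for every drawing, by the Schoenflies theorem; it is
  the usual convention that graphs are drawn tamely. -/
  tame : toGraphDrawing.IsTame
  cellular : toGraphDrawing.IsCellular

/-! The proof has a combinatorial half and a topological half.

Combinatorially, `m ≤ k` disjoint edges inside the neighbourhood of `v` force `d(v) ≥ n + k + m + 1`
(`IsNKGraph.degree_bound`). Were the degree smaller, one would try to delete `n` neighbours and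
cover all the others by at most `k` disjoint edges avoiding `v`; such a matching extends to no
perfect matching, since `v` has no partner left. The `m` given edges cover two neighbours each, and
the others must be matched to vertices outside the closed neighbourhood of `v`. If Hall's condition
fails for this, the deficient set cuts off a nonempty set `Z` of vertices from everything but the
`n` deleted ones, which contradicts connectedness when `n = 0` and parity when `n > 0`. Matchings
with fewer than `k` edges also extend, by `PairingsExtend.of_le`.

Topologically, the edges at `v` cut a small disk into sectors, each inside one face, and the two
edges bounding a sector of a triangular face have adjacent other ends (`IsStarChart.adj_of_sector`).
Hence the `x` triangular faces give adjacent consecutive pairs in the rotation at `v`, and half of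
these pairs, rounded up, can be chosen disjoint. If every sector is triangular, the neighbours carry
a path through all of them, which yields `k` disjoint edges. -/

/-! ### Matchings as involutions of finite vertex sets. -/

/-- The involution `f` matches the vertices of the finite set `U` in pairs of adjacent vertices. -/
structure SimpleGraph.IsPairing {V : Type*} (G : SimpleGraph V) (U : Finset V) (f : V → V) :
    Prop where
  mem : ∀ x ∈ U, f x ∈ U
  invol : ∀ x ∈ U, f (f x) = x
  adj : ∀ x ∈ U, G.Adj x (f x)

theorem Finset.two_mul_card_image_mk_involution {V : Type*} [DecidableEq V] (U : Finset V)
    (f : V → V) (mem : ∀ x ∈ U, f x ∈ U) (invol : ∀ x ∈ U, f (f x) = x)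
    (ne : ∀ x ∈ U, f x ≠ x) :
    2 * (U.image fun x => s(x, f x)).card = U.card := by
  classical
  have h := Finset.card_eq_sum_card_image (fun x => s(x, f x)) U
  rw [h, Finset.sum_const_nat (m := 2), mul_comm]
  intro e he
  obtain ⟨x, hx, rfl⟩ := Finset.mem_image.1 he
  have : U.filter (fun y => s(y, f y) = s(x, f x)) = {x, f x} := by
    ext y
    simp only [Finset.mem_filter, Finset.mem_insert, Finset.mem_singleton, Sym2.eq_iff]
    constructor
    · rintro ⟨-, h | h⟩
      · exact Or.inl h.1
      · exact Or.inr h.1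
    · rintro (rfl | rfl)
      · exact ⟨hx, Or.inl ⟨rfl, rfl⟩⟩
      · exact ⟨mem x hx, Or.inr ⟨rfl, invol x hx⟩⟩
  rw [this, Finset.card_pair (ne x hx).symm]

namespace SimpleGraph

namespace IsPairing

variable {V : Type*} {G : SimpleGraph V} {U W : Finset V} {f g : V → V}

theorem even_card (h : G.IsPairing U f) : Even U.card := by
  classical
  rw [← Finset.two_mul_card_image_mk_involution U f h.mem h.invol fun x hx => (h.adj x hx).ne']
  exact even_two_mul _

theorem empty (G : SimpleGraph V) (f : V → V) : G.IsPairing ∅ f := by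
  constructor <;> simp

theorem injOn (h : G.IsPairing U f) : Set.InjOn f U := by
  intro x hx y hy hxy
  rw [← h.invol x hx, hxy, h.invol y hy]

theorem sdiff [DecidableEq V] (h : G.IsPairing W g) (hU : ∀ x ∈ U, g x ∈ U) :
    G.IsPairing (W \ U) g := by
  refine ⟨fun x hx => ?_, fun x hx => h.invol x (Finset.mem_sdiff.1 hx).1,
    fun x hx => h.adj x (Finset.mem_sdiff.1 hx).1⟩
  obtain ⟨hx, hxU⟩ := Finset.mem_sdiff.1 hx
  refine Finset.mem_sdiff.2 ⟨h.mem x hx, fun hgx => hxU ?_⟩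
  rw [← h.invol x hx]
  exact hU _ hgx

/-- Add the edge `ab` to a pairing. -/
theorem insert [DecidableEq V] (h : G.IsPairing U f) {a b : V} (hab : G.Adj a b) (ha : a ∉ U)
    (hb : b ∉ U) :
    ∃ g, G.IsPairing (insert a (insert b U)) g ∧ (∀ x ∈ U, g x = f x) ∧ g a = b ∧ g b = a := by
  have hne := hab.ne
  have hga : Function.update (Function.update f a b) b a a = b := by
    rw [Function.update_of_ne hne, Function.update_self]
  have hgb : Function.update (Function.update f a b) b a b = a := Function.update_self ..
  have hgx : ∀ x ∈ U, Function.update (Function.update f a b) b a x = f x := fun x hx => by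
    rw [Function.update_of_ne (by rintro rfl; exact hb hx),
      Function.update_of_ne (by rintro rfl; exact ha hx)]
  refine ⟨Function.update (Function.update f a b) b a, ⟨?_, ?_, ?_⟩, hgx, hga, hgb⟩
  · intro x hx
    rcases Finset.mem_insert.1 hx with rfl | hx
    · rw [hga]; simp
    rcases Finset.mem_insert.1 hx with rfl | hx
    · rw [hgb]; simp
    · rw [hgx x hx]; simp [h.mem x hx]
  · intro x hx
    rcases Finset.mem_insert.1 hx with rfl | hx
    · rw [hga, hgb]
    rcases Finset.mem_insert.1 hx with rfl | hx
    · rw [hgb, hga]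
    · rw [hgx x hx, hgx _ (h.mem x hx), h.invol x hx]
  · intro x hx
    rcases Finset.mem_insert.1 hx with rfl | hx
    · rw [hga]; exact hab
    rcases Finset.mem_insert.1 hx with rfl | hx
    · rw [hgb]; exact hab.symm
    · rw [hgx x hx]; exact h.adj x hx

end IsPairing

variable {V : Type*} {G : SimpleGraph V}

/-- Each pairing of `2 j` vertices of `W` extends to a pairing of all of `W`. -/
def PairingsExtend (G : SimpleGraph V) (W : Finset V) (j : ℕ) : Prop :=
  ∀ U f, U ⊆ W → U.card = 2 * j → G.IsPairing U f → ∃ g, G.IsPairing W g ∧ ∀ x ∈ U, g x = f x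

/-! ### Translation between involutions and matchings as subgraphs. -/

theorem Subgraph.IsPerfectMatching.exists_isPairing {W : Finset V} {C : Set V}
    (hC : ∀ x, x ∈ C ↔ x ∈ W) {P : (G.induce C).Subgraph} (hP : P.IsPerfectMatching) :
    ∃ g, G.IsPairing W g ∧ ∀ x y : C, P.Adj x y → g x = y := by
  classical
  have hP' := Subgraph.isPerfectMatching_iff.1 hP
  choose m hm hmu using hP'
  obtain ⟨g, key⟩ : ∃ g : V → V, ∀ x y : C, P.Adj x y → g x = y := by
    refine ⟨fun x => if h : x ∈ C then (m ⟨x, h⟩ : V) else x, fun x y hxy => ?_⟩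
    simp only [x.2, dif_pos]
    exact congrArg Subtype.val (hmu x y hxy).symm
  refine ⟨g, ⟨?_, ?_, ?_⟩, key⟩
  · intro x hx
    rw [key ⟨x, (hC x).2 hx⟩ _ (hm _)]
    exact (hC _).1 (m _).2
  · intro x hx
    have h := hm ⟨x, (hC x).2 hx⟩
    rw [key ⟨x, (hC x).2 hx⟩ _ h]
    exact key _ _ h.symm
  · intro x hx
    have h := hm ⟨x, (hC x).2 hx⟩
    rw [key ⟨x, (hC x).2 hx⟩ _ h]
    exact P.adj_sub h

theorem IsPairing.exists_isMatching {U : Finset V} {f : V → V} (h : G.IsPairing U f) {C : Set V}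
    (hC : ∀ x ∈ U, x ∈ C) :
    ∃ M : (G.induce C).Subgraph, M.IsMatching ∧ 2 * M.edgeSet.ncard = U.card ∧
      ∀ x y : C, M.Adj x y ↔ (x : V) ∈ U ∧ f x = y := by
  classical
  let M : (G.induce C).Subgraph :=
    { verts := {x | (x : V) ∈ U}
      Adj := fun x y => (x : V) ∈ U ∧ f x = y
      adj_sub := by
        rintro x y ⟨hx, hxy⟩
        change G.Adj x y
        rw [← hxy]
        exact h.adj x hx
      edge_vert := fun h => h.1
      symm := ⟨by
        rintro x y ⟨hx, hxy⟩
        rw [← hxy]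
        exact ⟨h.mem x hx, h.invol x hx⟩⟩ }
  refine ⟨M, fun x hx => ⟨⟨f x, hC _ (h.mem x hx)⟩, ⟨hx, rfl⟩, fun y hy => Subtype.ext hy.2.symm⟩,
    ?_, fun x y => Iff.rfl⟩
  let f' : C → C := fun x => if hx : f x ∈ C then ⟨f x, hx⟩ else x
  have hf' : ∀ x : C, (x : V) ∈ U → (f' x : V) = f x := fun x hx => by
    simp [f', hC _ (h.mem x hx)]
  have hE : M.edgeSet = ((U.subtype (· ∈ C)).image fun x => s(x, f' x) : Finset (Sym2 C)) := by
    ext e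
    induction e with | _ x y
    simp only [Subgraph.mem_edgeSet, Finset.coe_image, Set.mem_image, Finset.mem_coe,
      Finset.mem_subtype, Sym2.eq_iff]
    constructor
    · rintro ⟨hx, hxy⟩
      exact ⟨x, hx, Or.inl ⟨rfl, Subtype.ext ((hf' x hx).trans hxy)⟩⟩
    · rintro ⟨z, hz, ⟨rfl, rfl⟩ | ⟨rfl, rfl⟩⟩
      · exact ⟨hz, (hf' z hz).symm⟩
      · exact M.symm.symm _ _ ⟨hz, (hf' z hz).symm⟩
  rw [hE, Set.ncard_coe_finset, Finset.two_mul_card_image_mk_involution]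
  · rw [Finset.card_subtype, Finset.filter_true_of_mem hC]
  · intro x hx
    rw [Finset.mem_subtype] at hx ⊢
    rw [hf' x hx]
    exact h.mem x hx
  · intro x hx
    rw [Finset.mem_subtype] at hx
    apply Subtype.ext
    rw [hf' _ (by rw [hf' x hx]; exact h.mem x hx), hf' x hx, h.invol x hx]
  · intro x hx hxx
    rw [Finset.mem_subtype] at hx
    have := hf' x hx
    rw [hxx] at this
    exact (h.adj x hx).ne this

theorem IsExtendable.pairingsExtend {W : Finset V} {C : Set V} (hC : ∀ x, x ∈ C ↔ x ∈ W) {k : ℕ}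
    (h : (G.induce C).IsExtendable k) :
    (∃ g, G.IsPairing W g) ∧ G.PairingsExtend W k := by
  obtain ⟨⟨P, hP⟩, h⟩ := h
  refine ⟨(hP.exists_isPairing hC).imp fun g hg => hg.1, fun U f hUW hU hf => ?_⟩
  obtain ⟨M, hM, hcard, hadj⟩ := hf.exists_isMatching (fun x hx => (hC x).2 (hUW hx))
  obtain ⟨P, hP, hMP⟩ := h M hM (by omega)
  obtain ⟨g, hg, hPg⟩ := hP.exists_isPairing hC
  refine ⟨g, hg, fun x hx => ?_⟩
  exact hPg ⟨x, (hC x).2 (hUW hx)⟩ ⟨f x, (hC _).2 (hUW (hf.mem x hx))⟩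
    (hMP.2 ((hadj _ _).2 ⟨hx, rfl⟩))

/-- If an edge avoids `U`, add it and extend. Otherwise `W \ U` is independent, and exchanging one
edge of `f` for an edge of the fixed perfect pairing `p` gives a matching closer to `p`. By
induction that matching extends, but then too many vertices of the independent set compete for the
one vertex released by the exchange. -/
theorem PairingsExtend.of_succ {W : Finset V} {p : V → V} (hp : G.IsPairing W p) {j : ℕ}
    (hW : 2 * j + 4 ≤ W.card) (h : G.PairingsExtend W (j + 1)) : G.PairingsExtend W j := by
  classical
  intro U f
  induction hN : (U.filter fun x => f x ≠ p x).card using Nat.strong_induction_on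
    generalizing U f with
  | _ N ih =>
  intro hUW hU hf
  by_cases hex : ∃ a ∈ W \ U, ∃ b ∈ W \ U, G.Adj a b
  · obtain ⟨a, ha, b, hb, hab⟩ := hex
    rw [Finset.mem_sdiff] at ha hb
    obtain ⟨g, hg, hgf, -⟩ := hf.insert hab ha.2 hb.2
    obtain ⟨q, hq, hqg⟩ := h _ g
      (Finset.insert_subset ha.1 (Finset.insert_subset hb.1 hUW))
      (by rw [Finset.card_insert_of_notMem, Finset.card_insert_of_notMem hb.2, hU]
          · ring
          · simp [hab.ne, ha.2]) hg
    exact ⟨q, hq, fun x hx => by rw [hqg x (by simp [hx]), hgf x hx]⟩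
  push Not at hex
  have hcard : (W \ U).card = W.card - U.card := Finset.card_sdiff_of_subset hUW
  obtain ⟨u, hu⟩ : (W \ U).Nonempty := Finset.card_pos.1 (by omega)
  have hu' := Finset.mem_sdiff.1 hu
  have hpu : p u ∈ U := by
    by_contra hpu
    exact hex u hu (p u) (Finset.mem_sdiff.2 ⟨hp.mem u hu'.1, hpu⟩) (hp.adj u hu'.1)
  -- The edge from `a` to `f a` is replaced by `ua`, which belongs to `p`; this lowers the number of
  -- disagreements and releases only `f a`.
  set a := p u with ha
  have hpa : p a = u := hp.invol u hu'.1
  have hfa : f a ∈ U := hf.mem a hpu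
  have hpair : ∀ x ∈ ({a, f a} : Finset V), f x ∈ ({a, f a} : Finset V) := by
    intro x hx
    rcases Finset.mem_insert.1 hx with rfl | hx
    · simp
    · rw [Finset.mem_singleton.1 hx, hf.invol a hpu]; simp
  have hsub : ({a, f a} : Finset V) ⊆ U := by
    intro x hx
    rcases Finset.mem_insert.1 hx with rfl | hx
    · exact hpu
    · rw [Finset.mem_singleton.1 hx]; exact hfa
  have hne : a ≠ f a := (hf.adj a hpu).ne
  have hf0 := hf.sdiff hpair
  obtain ⟨f', hf', hff', hfu', hfa'⟩ :=
    hf0.insert (hp.adj u hu'.1) (by simp [hu'.2]) (by simp [← ha])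
  have hc0 : (U \ {a, f a}).card = 2 * j - 2 := by
    rw [Finset.card_sdiff_of_subset hsub, Finset.card_pair hne, hU]
  have hU2 : 2 ≤ 2 * j := by
    rw [← hU, ← Finset.card_pair hne]; exact Finset.card_le_card hsub
  have hua : u ≠ a := (hp.adj u hu'.1).ne
  have hU'W : insert u (insert a (U \ {a, f a})) ⊆ W :=
    Finset.insert_subset hu'.1 (Finset.insert_subset (hUW hpu) (Finset.sdiff_subset.trans hUW))
  obtain ⟨q, hq, hqf⟩ := ih _ (by
    rw [← hN]
    apply Finset.card_lt_card
    refine (Finset.ssubset_iff_of_subset ?_).2 ⟨a, ?_, ?_⟩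
    · intro x hx
      obtain ⟨hx, hxp⟩ := Finset.mem_filter.1 hx
      rcases Finset.mem_insert.1 hx with rfl | hx
      · exact absurd hfu' hxp
      rcases Finset.mem_insert.1 hx with rfl | hx
      · exact absurd (hfa'.trans hpa.symm) hxp
      · rw [hff' x hx] at hxp
        exact Finset.mem_filter.2 ⟨(Finset.mem_sdiff.1 hx).1, hxp⟩
    · refine Finset.mem_filter.2 ⟨hpu, fun h => hu'.2 ?_⟩
      rw [← hpa, ← h]; exact hfa
    · intro h
      exact (Finset.mem_filter.1 h).2 (hfa'.trans hpa.symm)) _ f' rfl hU'W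
    (by rw [Finset.card_insert_of_notMem (by simp [hu'.2, hua]),
      Finset.card_insert_of_notMem (by simp), hc0]; omega) hf'
  exfalso
  -- Outside the new matching there remain only `f a` and the independent set `W \ U` without `u`,
  -- so `f a` is the only possible partner. At least three vertices need it.
  have hlast : ∀ z ∈ (W \ U).erase u, q z = f a := by
    intro z hz
    obtain ⟨hzu, hz⟩ := Finset.mem_erase.1 hz
    have hz' := Finset.mem_sdiff.1 hz
    have hqz : q z ∈ U := by
      by_contra hqz
      exact hex z hz _ (Finset.mem_sdiff.2 ⟨hq.mem z hz'.1, hqz⟩) (hq.adj z hz'.1)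
    by_contra hzb
    have hmem : q z ∈ insert u (insert a (U \ {a, f a})) := by
      by_cases hqa : q z = a <;> simp [hqa, hzb, hqz]
    have h1 := hf'.mem _ hmem
    rw [← hqf _ hmem, hq.invol z hz'.1] at h1
    rcases Finset.mem_insert.1 h1 with rfl | h1
    · exact hzu rfl
    rcases Finset.mem_insert.1 h1 with rfl | h1
    · exact hz'.2 hpu
    · exact hz'.2 (Finset.mem_sdiff.1 h1).1
  have h1 : 1 < ((W \ U).erase u).card := by
    rw [Finset.card_erase_of_mem hu]; omega
  obtain ⟨y, hy, z, hz, hyz⟩ := Finset.one_lt_card.1 h1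
  exact hyz (hq.injOn (Finset.mem_sdiff.1 (Finset.mem_of_mem_erase hy)).1
    (Finset.mem_sdiff.1 (Finset.mem_of_mem_erase hz)).1 ((hlast y hy).trans (hlast z hz).symm))

theorem PairingsExtend.of_le {W : Finset V} {p : V → V} (hp : G.IsPairing W p) {j k : ℕ}
    (hjk : j ≤ k) (hW : 2 * k + 2 ≤ W.card) (h : G.PairingsExtend W k) :
    G.PairingsExtend W j := by
  induction hjk using Nat.decreasingInduction with
  | self => exact h
  | of_succ i hi ih => exact ih.of_succ hp (by omega)

theorem IsNKGraph.pairingsExtend [Fintype V] [DecidableEq V] {n k : ℕ} (hG : G.IsNKGraph n k)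
    {S : Finset V} (hS : S.card = n) {j : ℕ} (hj : j ≤ k) : G.PairingsExtend Sᶜ j := by
  obtain ⟨⟨p, hp⟩, h⟩ := (hG.2.2 S hS).pairingsExtend (W := Sᶜ) (fun x => by simp)
  refine h.of_le hp hj ?_
  have := hG.1
  rw [Finset.card_compl]
  omega

end SimpleGraph

/-! ### The degree bound from disjoint edges among the neighbours. -/

namespace SimpleGraph

variable {V : Type*} {G : SimpleGraph V}

theorem IsPairing.mono {U W : Finset V} {g : V → V} (h : G.IsPairing W g) (hUW : U ⊆ W)
    (hU : ∀ x ∈ U, g x ∈ U) : G.IsPairing U g :=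
  ⟨hU, fun x hx => h.invol x (hUW hx), fun x hx => h.adj x (hUW hx)⟩

/-- Add the disjoint edges `(a i) (b i)`, where `i ∈ T`, to a pairing. -/
theorem IsPairing.exists_union [DecidableEq V] {ι : Type*} {U : Finset V} {f : V → V}
    (hf : G.IsPairing U f) (T : Finset ι) (a b : ι → V) (ha : Set.InjOn a T) (hb : Set.InjOn b T)
    (hab : ∀ i ∈ T, ∀ j ∈ T, a i ≠ b j) (haU : ∀ i ∈ T, a i ∉ U) (hbU : ∀ i ∈ T, b i ∉ U)
    (hadj : ∀ i ∈ T, G.Adj (a i) (b i)) :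
    (∃ g, G.IsPairing (U ∪ T.image a ∪ T.image b) g) ∧
      (U ∪ T.image a ∪ T.image b).card = U.card + 2 * T.card := by
  classical
  constructor
  · induction T using Finset.induction_on with
    | empty => exact ⟨f, by simpa using hf⟩
    | insert i T hi ih =>
      have hsub : (T : Set ι) ⊆ (Insert.insert i T : Finset ι) := by simp
      obtain ⟨g, hg⟩ := ih (ha.mono hsub) (hb.mono hsub)
        (fun j hj l hl => hab j (Finset.mem_insert_of_mem hj) l (Finset.mem_insert_of_mem hl))
        (fun j hj => haU j (Finset.mem_insert_of_mem hj))
        (fun j hj => hbU j (Finset.mem_insert_of_mem hj))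
        (fun j hj => hadj j (Finset.mem_insert_of_mem hj))
      have hi' : i ∈ Insert.insert i T := Finset.mem_insert_self i T
      have h1 : a i ∉ U ∪ T.image a ∪ T.image b := by
        simp only [Finset.mem_union, Finset.mem_image, not_or, not_exists, not_and]
        refine ⟨⟨haU i hi', fun j hj h => hi ?_⟩, fun j hj h => ?_⟩
        · rwa [← ha (Finset.mem_insert_of_mem hj) hi' h]
        · exact hab i hi' j (Finset.mem_insert_of_mem hj) h.symm
      have h2 : b i ∉ U ∪ T.image a ∪ T.image b := by
        simp only [Finset.mem_union, Finset.mem_image, not_or, not_exists, not_and]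
        refine ⟨⟨hbU i hi', fun j hj h => ?_⟩, fun j hj h => hi ?_⟩
        · exact hab j (Finset.mem_insert_of_mem hj) i hi' h
        · rwa [← hb (Finset.mem_insert_of_mem hj) hi' h]
      obtain ⟨q, hq, -⟩ := hg.insert (hadj i hi') h1 h2
      refine ⟨q, ?_⟩
      convert hq using 1
      ext x
      simp only [Finset.image_insert, Finset.mem_union, Finset.mem_insert]
      tauto
  · rw [Finset.card_union_of_disjoint, Finset.card_union_of_disjoint,
      Finset.card_image_of_injOn ha, Finset.card_image_of_injOn hb]
    · ring
    · rw [Finset.disjoint_right]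
      intro x hx
      obtain ⟨i, hi, rfl⟩ := Finset.mem_image.1 hx
      exact haU i hi
    · rw [Finset.disjoint_right]
      intro x hx
      obtain ⟨i, hi, rfl⟩ := Finset.mem_image.1 hx
      simp only [Finset.mem_union, Finset.mem_image, not_or, not_exists, not_and]
      exact ⟨hbU i hi, fun j hj h => hab j hj i hi h⟩

variable [Fintype V]

/-- In an `(n, k)`-graph a vertex cannot be isolated by deleting `n` vertices and the vertices of
at most `k` disjoint edges. -/
theorem IsNKGraph.not_isolated {n k : ℕ} (hG : G.IsNKGraph n k) {S U : Finset V} {f : V → V}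
    {v : V} (hS : S.card = n) (hf : G.IsPairing U f) (hUk : U.card ≤ 2 * k) (hSU : Disjoint S U)
    (hvS : v ∉ S) (hvU : v ∉ U) (hN : ∀ x, G.Adj v x → x ∈ S ∨ x ∈ U) : False := by
  classical
  obtain ⟨j, hj⟩ := hf.even_card
  obtain ⟨g, hg, hgf⟩ := hG.pairingsExtend hS (j := j) (by omega) U f
    (fun x hx => Finset.mem_compl.2 (Finset.disjoint_right.1 hSU hx)) (by omega) hf
  have hv := Finset.mem_compl.2 hvS
  rcases hN _ (hg.adj v hv) with h | h
  · exact Finset.mem_compl.1 (hg.mem v hv) h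
  · apply hvU
    rw [← hg.invol v hv, hgf _ h]
    exact hf.mem _ h

/-- The case where the `m` edges are maximal, so that the neighbours they miss are independent. This
independence confines the neighbours of a Hall-deficient set `A` to `U`, `v` and the set `B` with
`|B| < |A|`. -/
theorem IsNKGraph.degree_bound_of_maximal [DecidableRel G.Adj] {n k : ℕ} (hG : G.IsNKGraph n k)
    (hconn : G.Connected) {v : V} {U : Finset V} {f : V → V}
    (hf : G.IsPairing U f) (hUv : ∀ x ∈ U, G.Adj v x) {m : ℕ} (hU : U.card = 2 * m) (hm : m < k)
    (hind : ∀ x y, G.Adj v x → G.Adj v y → x ∉ U → y ∉ U → ¬ G.Adj x y) :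
    n + k + m + 1 ≤ G.degree v := by
  classical
  by_contra! hdeg
  have hvU : v ∉ U := fun h => (hUv v h).ne rfl
  have hUN : U ⊆ G.neighborFinset v := fun x hx => (G.mem_neighborFinset v x).2 (hUv x hx)
  obtain ⟨R, hR⟩ : ∃ R, R = G.neighborFinset v \ U := ⟨_, rfl⟩
  have hRmem : ∀ x, x ∈ R ↔ G.Adj v x ∧ x ∉ U := by simp [hR]
  have hRcard : R.card + 2 * m = G.degree v := by
    rw [hR, ← hU, Finset.card_sdiff_add_card_eq_card hUN, G.card_neighborFinset_eq_degree]
  have hvR : v ∉ R := fun h => ((hRmem v).1 h).1.ne rfl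
  have hV := hG.1
  -- If at most `n` neighbours are uncovered, deleting them all already isolates `v`.
  rcases le_or_gt R.card n with hRn | hRn
  · obtain ⟨S, hRS, hSU, hS⟩ := Finset.exists_subsuperset_card_eq
      (s := R) (t := (insert v U)ᶜ) (n := n) (by
        intro x hx
        rw [Finset.mem_compl, Finset.mem_insert, not_or]
        exact ⟨by rintro rfl; exact hvR hx, ((hRmem x).1 hx).2⟩) hRn (by
        rw [Finset.card_compl, Finset.card_insert_of_notMem hvU]; omega)
    have hSU' : ∀ x ∈ S, x ≠ v ∧ x ∉ U := fun x hx => by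
      simpa using hSU hx
    exact hG.not_isolated hS hf (by omega)
      (Finset.disjoint_left.2 fun x hx => (hSU' x hx).2) (fun h => (hSU' v h).1 rfl) hvU
      (fun x hx => by
        by_cases h : x ∈ U
        · exact Or.inr h
        · exact Or.inl (hRS ((hRmem x).2 ⟨hx, h⟩)))
  obtain ⟨S, hSR, hS⟩ := Finset.exists_subset_card_eq hRn.le
  have hSv : ∀ x ∈ S, G.Adj v x := fun x hx => ((hRmem x).1 (hSR hx)).1
  have hSU : ∀ x ∈ S, x ∉ U := fun x hx => ((hRmem x).1 (hSR hx)).2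
  have hvS : v ∉ S := fun h => (hSv v h).ne rfl
  -- The partners allowed for a remaining neighbour lie outside the closed neighbourhood of `v`, so
  -- the new edges avoid `S`, `U` and `R`.
  let t : V → Finset V := fun x => Finset.univ.filter fun y => G.Adj x y ∧ y ≠ v ∧ ¬ G.Adj v y
  have ht : ∀ x y, y ∈ t x ↔ G.Adj x y ∧ y ≠ v ∧ ¬ G.Adj v y := by simp [t]
  have hR'card : (R \ S).card = R.card - n := by rw [Finset.card_sdiff_of_subset hSR, hS]
  have hR' : ∀ x ∈ R \ S, G.Adj v x ∧ x ∉ U ∧ x ∉ S := fun x hx => by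
    rw [Finset.mem_sdiff, hRmem] at hx
    exact ⟨hx.1.1, hx.1.2, hx.2⟩
  -- At most `k - m` neighbours remain in `R \ S`, so a system of distinct partners would complete
  -- `U` to at most `k` edges and isolate `v`.
  have hkey : ¬ ∃ h : (↥(R \ S)) → V, Function.Injective h ∧ ∀ x : ↥(R \ S), h x ∈ t x := by
    rintro ⟨h, hinj, hht⟩
    obtain ⟨⟨g, hg⟩, hcard⟩ := hf.exists_union (Finset.univ : Finset ↥(R \ S))
      (fun x => (x : V)) h Subtype.val_injective.injOn hinj.injOn
      (fun i _ j _ hij => ((ht _ _).1 (hht j)).2.2 (hij ▸ (hR' i i.2).1))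
      (fun i _ => (hR' i i.2).2.1) (fun i _ hi => ((ht _ _).1 (hht i)).2.2 (hUv _ hi))
      (fun i _ => ((ht _ _).1 (hht i)).1)
    rw [Finset.card_univ, Fintype.card_coe] at hcard
    refine hG.not_isolated (v := v) hS hg (by omega) ?_ hvS ?_ ?_
    · rw [Finset.disjoint_left]
      intro x hx
      simp only [Finset.mem_union, Finset.mem_image, not_or, not_exists, not_and]
      refine ⟨⟨hSU x hx, fun i _ hi => (hR' i i.2).2.2 (hi ▸ hx)⟩, fun i _ hi => ?_⟩
      exact ((ht _ _).1 (hht i)).2.2 (hi ▸ hSv x hx)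
    · simp only [Finset.mem_union, Finset.mem_image, not_or, not_exists, not_and]
      exact ⟨⟨hvU, fun i _ hi => (hR' i i.2).1.ne hi.symm⟩,
        fun i _ hi => ((ht _ _).1 (hht i)).2.1 hi⟩
    · intro x hx
      by_cases hxS : x ∈ S
      · exact Or.inl hxS
      · refine Or.inr ?_
        simp only [Finset.mem_union, Finset.mem_image]
        by_cases hxU : x ∈ U
        · exact Or.inl (Or.inl hxU)
        · exact Or.inl (Or.inr ⟨⟨x, Finset.mem_sdiff.2 ⟨(hRmem x).2 ⟨hx, hxU⟩, hxS⟩⟩,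
            Finset.mem_univ _, rfl⟩)
  rw [← Finset.all_card_le_biUnion_card_iff_exists_injective] at hkey
  push Not at hkey
  obtain ⟨A', hA'⟩ := hkey
  obtain ⟨A, hA⟩ : ∃ A : Finset V, A = A'.map (Function.Embedding.subtype _) := ⟨_, rfl⟩
  obtain ⟨B, hB⟩ : ∃ B : Finset V, B = A.biUnion t := ⟨_, rfl⟩
  have hAR : A ⊆ R \ S := by
    intro x hx
    rw [hA] at hx
    obtain ⟨y, -, rfl⟩ := Finset.mem_map.1 hx
    exact y.2
  have hBA : B.card < A.card := by
    have hB' : B = A'.biUnion fun x => t x := by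
      rw [hB, hA]
      ext y
      simp
    rwa [hB', hA, Finset.card_map]
  have hBmem : ∀ y ∈ B, y ≠ v ∧ ¬ G.Adj v y := by
    intro y hy
    rw [hB] at hy
    obtain ⟨x, -, hx⟩ := Finset.mem_biUnion.1 hy
    exact ((ht _ _).1 hx).2
  have hAv : ∀ x ∈ A, G.Adj v x := fun x hx => (hR' x (hAR hx)).1
  have hAU : ∀ x ∈ A, x ∉ U := fun x hx => (hR' x (hAR hx)).2.1
  have hAS : ∀ x ∈ A, x ∉ S := fun x hx => (hR' x (hAR hx)).2.2
  have hAN : ∀ x ∈ A, ∀ y, G.Adj x y → y ∈ U ∨ y ∈ insert v B := by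
    intro x hx y hxy
    by_cases hyU : y ∈ U
    · exact Or.inl hyU
    refine Or.inr (Finset.mem_insert.2 ?_)
    by_cases hyv : y = v
    · exact Or.inl hyv
    refine Or.inr ?_
    rw [hB, Finset.mem_biUnion]
    exact ⟨x, hx, (ht x y).2 ⟨hxy, hyv, fun h => hind x y (hAv x hx) h (hAU x hx) hyU hxy⟩⟩
  have hvB : v ∉ B := fun h => (hBmem v h).1 rfl
  have hYcard : (insert v B).card = B.card + 1 := Finset.card_insert_of_notMem hvB
  have hYA : ∀ y ∈ insert v B, y ∉ A := by
    intro y hy hyA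
    rcases Finset.mem_insert.1 hy with rfl | hy
    · exact (hAv _ hyA).ne rfl
    · exact (hBmem y hy).2 (hAv y hyA)
  have hYU : ∀ y ∈ insert v B, y ∉ U := by
    intro y hy hyU
    rcases Finset.mem_insert.1 hy with rfl | hy
    · exact hvU hyU
    · exact (hBmem y hy).2 (hUv y hyU)
  have hYS : ∀ y ∈ insert v B, y ∉ S := by
    intro y hy hyS
    rcases Finset.mem_insert.1 hy with rfl | hy
    · exact hvS hyS
    · exact (hBmem y hy).2 (hSv y hyS)
  -- With `U` covered, `A` must be matched into `insert v B`, which has at most `|A|` elements. A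
  -- matching of `m + 1` edges that also uses one of these, but no vertex of `A`, leaves too few.
  have hK : ∀ (U₂ : Finset V) (f₂ : V → V) (y : V), G.IsPairing U₂ f₂ → U₂.card = 2 * (m + 1) →
      (∀ x ∈ U₂, x ∉ S) → (∀ x ∈ U₂, x ∉ A) → U ⊆ U₂ → y ∈ U₂ → y ∈ insert v B → False := by
    intro U₂ f₂ y hf₂ hU₂ hU₂S hU₂A hUU₂ hyU₂ hyY
    obtain ⟨g, hg, hgf⟩ := hG.pairingsExtend hS (j := m + 1) hm U₂ f₂
      (fun x hx => Finset.mem_compl.2 (hU₂S x hx)) hU₂ hf₂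
    have hgA : ∀ x ∈ A, g x ∉ U₂ := by
      intro x hx h
      apply hU₂A _ (hf₂.mem _ h)
      rw [← hgf _ h, hg.invol x (Finset.mem_compl.2 (hAS x hx))]
      exact hx
    have hle : A.card ≤ ((insert v B).erase y).card := by
      refine Finset.card_le_card_of_injOn g (fun x hx => ?_) (hg.injOn.mono fun x hx =>
        Finset.mem_compl.2 (hAS x hx))
      refine Finset.mem_erase.2 ⟨fun h => hgA x hx (h ▸ hyU₂), ?_⟩
      exact (hAN x hx _ (hg.adj x (Finset.mem_compl.2 (hAS x hx)))).resolve_left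
        fun h => hgA x hx (hUU₂ h)
    rw [Finset.card_erase_of_mem hyY] at hle
    omega
  -- `Z` is everything else in `G - S`. An edge leaving it, other than to `S`, would allow a
  -- matching forbidden by `hK`.
  obtain ⟨Z, hZ⟩ : ∃ Z : Finset V, Z = Sᶜ \ (A ∪ insert v B ∪ U) := ⟨_, rfl⟩
  have hZmem : ∀ z, z ∈ Z ↔ z ∉ S ∧ z ∉ A ∧ z ∉ insert v B ∧ z ∉ U := by
    intro z
    rw [hZ]
    simp only [Finset.mem_sdiff, Finset.mem_compl, Finset.mem_union, not_or, and_assoc]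
  have hZadj : ∀ z ∈ Z, ∀ y, G.Adj z y → y ∈ Z ∨ y ∈ S := by
    intro z hz y hzy
    by_contra! hy
    rw [hZmem] at hz hy
    obtain ⟨hzS, hzA, hzY, hzU⟩ := hz
    have hy' : y ∈ A ∨ y ∈ insert v B ∨ y ∈ U := by
      by_contra! h
      exact hy.1 ⟨hy.2, h⟩
    rcases hy' with hyA | hyY | hyU
    · exact (hAN y hyA z hzy.symm).elim hzU hzY
    · obtain ⟨g, hg, -⟩ := hf.insert hzy hzU (hYU y hyY)
      refine hK _ g y hg ?_ ?_ ?_ ?_ (by simp) hyY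
      · rw [Finset.card_insert_of_notMem, Finset.card_insert_of_notMem (hYU y hyY), hU]
        · ring
        · simp [hzy.ne, hzU]
      · simp only [Finset.mem_insert, forall_eq_or_imp]
        exact ⟨hzS, hYS y hyY, fun x hx h => hSU x h hx⟩
      · simp only [Finset.mem_insert, forall_eq_or_imp]
        exact ⟨hzA, hYA y hyY, fun x hx h => hAU x h hx⟩
      · exact (Finset.subset_insert _ _).trans (Finset.subset_insert _ _)
    -- The edge from `y` to `f y` is replaced by the two edges `zy` and `v (f y)`, so that `v`
    -- itself is the covered element of `insert v B`.
    · have hfy := hf.mem y hyU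
      have hne := (hf.adj y hyU).ne
      have hsub : ({y, f y} : Finset V) ⊆ U := by
        intro x hx
        rcases Finset.mem_insert.1 hx with rfl | hx
        · exact hyU
        · rw [Finset.mem_singleton.1 hx]; exact hfy
      have hf0 : G.IsPairing (U \ {y, f y}) f := hf.sdiff (by simp [hf.invol y hyU])
      have hc0 : (U \ {y, f y}).card + 2 = U.card := by
        rw [← Finset.card_pair hne]
        exact Finset.card_sdiff_add_card_eq_card hsub
      have hzv : z ≠ v := by rintro rfl; simp at hzY
      have hyv : y ≠ v := by rintro rfl; exact hvU hyU
      have hzfy : z ≠ f y := by rintro rfl; exact hzU hfy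
      obtain ⟨f₁, hf₁, -⟩ := hf0.insert (hUv _ hfy) (by simp [hvU]) (by simp)
      have h1 : z ∉ insert v (insert (f y) (U \ {y, f y})) := by
        simp [hzv, hzfy, hzU]
      have h2 : y ∉ insert v (insert (f y) (U \ {y, f y})) := by
        simp [hyv, hne]
      have h3 : v ∉ insert (f y) (U \ {y, f y}) := by
        simp [hvU, (hUv _ hfy).ne]
      obtain ⟨f₂, hf₂, -⟩ := hf₁.insert hzy h1 h2
      refine hK _ f₂ v hf₂ ?_ ?_ ?_ ?_ (by simp) (by simp)
      · rw [Finset.card_insert_of_notMem, Finset.card_insert_of_notMem h2,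
          Finset.card_insert_of_notMem h3, Finset.card_insert_of_notMem (by simp)]
        · omega
        · rw [Finset.mem_insert, not_or]
          exact ⟨hzy.ne, h1⟩
      · simp only [Finset.mem_insert, forall_eq_or_imp, Finset.mem_sdiff]
        exact ⟨hzS, fun h => hSU y h hyU, hvS, fun h => hSU _ h hfy,
          fun x hx h => hSU x h hx.1⟩
      · simp only [Finset.mem_insert, forall_eq_or_imp, Finset.mem_sdiff]
        exact ⟨hzA, fun h => hAU y h hyU, hYA v (by simp), fun h => hAU _ h hfy,
          fun x hx h => hAU x h hx.1⟩
      · intro x hx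
        simp only [Finset.mem_insert, Finset.mem_sdiff, Finset.mem_singleton]
        tauto
  have hvZ : v ∉ Z := fun h => ((hZmem v).1 h).2.2.1 (by simp)
  -- `S`, `A`, `insert v B` and `U` have at most `n + (k - m) + (k - m) + 2 * m = n + 2 * k`
  -- elements in all.
  obtain ⟨z, hz⟩ : Z.Nonempty := by
    rw [← Finset.card_pos, hZ]
    have h1 := Finset.le_card_sdiff (A ∪ insert v B ∪ U) Sᶜ
    have h2 := Finset.card_union_le (A ∪ insert v B) U
    have h3 := Finset.card_union_le A (insert v B)
    have h4 := Finset.card_le_card hAR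
    rw [Finset.card_compl] at h1
    omega
  rcases S.eq_empty_or_nonempty with hSe | ⟨s, hs⟩
  · obtain ⟨p⟩ := hconn.preconnected z v
    obtain ⟨e, -, he1, he2⟩ := p.exists_boundary_dart (Z : Set V) hz hvZ
    rcases hZadj _ he1 _ e.adj with h | h
    · exact he2 h
    · simp [hSe] at h
  -- A perfect matching of `G - S` pairs `Z` within itself, so `|Z|` is even. Exchange `s` for `z`
  -- in the deleted set and prescribe the edge `sv`: now `Z` without `z` is paired within itself, so
  -- `|Z| - 1` is even too.
  · have hzS := ((hZmem z).1 hz).1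
    have hS' : (insert z (S.erase s)).card = n := by
      have := Finset.card_pos.2 ⟨s, hs⟩
      rw [Finset.card_insert_of_notMem (by simp [hzS]), Finset.card_erase_of_mem hs]
      omega
    obtain ⟨p, hp, -⟩ := hG.pairingsExtend hS (Nat.zero_le k) ∅ id (by simp) (by simp)
      (IsPairing.empty G id)
    have hZS : ∀ x ∈ Z, x ∈ Sᶜ := fun x hx => Finset.mem_compl.2 ((hZmem x).1 hx).1
    have heven : Even Z.card := by
      refine (hp.mono (U := Z) hZS fun x hx => ?_).even_card
      exact (hZadj x hx _ (hp.adj x (hZS x hx))).resolve_right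
        (Finset.mem_compl.1 (hp.mem x (hZS x hx)))
    obtain ⟨q, hq, -, hqs, -⟩ := (IsPairing.empty G id).insert (hSv s hs).symm (by simp) (by simp)
    have hvz : v ≠ z := by rintro rfl; exact hvZ hz
    have hsz : s ≠ z := by rintro rfl; exact hzS hs
    obtain ⟨g, hg, hgq⟩ := hG.pairingsExtend hS' (j := 1) (by omega) _ q (by
      intro x hx
      simp only [Finset.mem_insert, Finset.notMem_empty, or_false] at hx
      rcases hx with rfl | rfl
      · simp [hsz]
      · simp [hvz, hvS]) (by rw [insert_empty_eq, Finset.card_pair (hSv s hs).ne']) hq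
    have hgs : g s = v := (hgq s (by simp)).trans hqs
    have hsS' : s ∈ (insert z (S.erase s))ᶜ := by simp [hsz]
    have hZS' : ∀ x ∈ Z.erase z, x ∈ (insert z (S.erase s))ᶜ := by
      intro x hx
      obtain ⟨hxz, hx⟩ := Finset.mem_erase.1 hx
      simp [hxz, ((hZmem x).1 hx).1]
    have heven' : Even (Z.erase z).card := by
      refine (hg.mono (U := Z.erase z) hZS' fun x hx => ?_).even_card
      have hgx := hg.mem x (hZS' x hx)
      simp only [Finset.mem_compl, Finset.mem_insert, Finset.mem_erase, not_or, not_and] at hgx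
      refine Finset.mem_erase.2 ⟨hgx.1, ?_⟩
      refine (hZadj x (Finset.mem_of_mem_erase hx) _ (hg.adj x (hZS' x hx))).resolve_right
        fun h => ?_
      by_cases hgxs : g x = s
      · have := hg.invol x (hZS' x hx)
        rw [hgxs, hgs] at this
        rw [← this] at hx
        exact hvZ (Finset.mem_of_mem_erase hx)
      · exact hgx.2 hgxs h
    rw [Finset.card_erase_of_mem hz] at heven'
    have := Finset.card_pos.2 ⟨z, hz⟩
    obtain ⟨i, hi⟩ := heven
    obtain ⟨j, hj⟩ := heven'
    omega

/-- If the neighbours of a vertex `v` of a connected `(n, k)`-graph contain `m ≤ k` disjoint edges,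
then `v` has at least `n + k + m + 1` neighbours. -/
theorem IsNKGraph.degree_bound [DecidableRel G.Adj] {n k : ℕ} (hG : G.IsNKGraph n k)
    (hconn : G.Connected) {v : V} {U : Finset V} {f : V → V}
    (hf : G.IsPairing U f) (hUv : ∀ x ∈ U, G.Adj v x) {m : ℕ} (hU : U.card = 2 * m) (hm : m ≤ k) :
    n + k + m + 1 ≤ G.degree v := by
  classical
  induction hm using Nat.decreasingInduction generalizing U f with
  | self =>
    by_contra! hdeg
    have hV := hG.1
    have hvU : v ∉ U := fun h => (hUv v h).ne rfl
    have hUN : U ⊆ G.neighborFinset v := fun x hx => (G.mem_neighborFinset v x).2 (hUv x hx)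
    have hRcard := Finset.card_sdiff_add_card_eq_card hUN
    rw [G.card_neighborFinset_eq_degree] at hRcard
    obtain ⟨S, hRS, hSU, hS⟩ := Finset.exists_subsuperset_card_eq
      (s := G.neighborFinset v \ U) (t := (insert v U)ᶜ) (n := n) (by
        intro x hx
        rw [Finset.mem_sdiff, mem_neighborFinset] at hx
        rw [Finset.mem_compl, Finset.mem_insert, not_or]
        exact ⟨hx.1.ne', hx.2⟩) (by omega) (by
        rw [Finset.card_compl, Finset.card_insert_of_notMem hvU]; omega)
    have hSU' : ∀ x ∈ S, x ≠ v ∧ x ∉ U := fun x hx => by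
      simpa using hSU hx
    refine hG.not_isolated hS hf (by omega)
      (Finset.disjoint_left.2 fun x hx => (hSU' x hx).2) (fun h => (hSU' v h).1 rfl) hvU
      (fun x hx => ?_)
    by_cases h : x ∈ U
    · exact Or.inr h
    · exact Or.inl (hRS (by simp [hx, h]))
  | of_succ i hi ih =>
    by_cases h : ∃ x y, G.Adj v x ∧ G.Adj v y ∧ x ∉ U ∧ y ∉ U ∧ G.Adj x y
    · obtain ⟨x, y, hx, hy, hxU, hyU, hxy⟩ := h
      obtain ⟨g, hg, -⟩ := hf.insert hxy hxU hyU
      have := ih hg (by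
        simp only [Finset.mem_insert, forall_eq_or_imp]
        exact ⟨hx, hy, hUv⟩) (by
        rw [Finset.card_insert_of_notMem (by simp [hxy.ne, hxU]), Finset.card_insert_of_notMem hyU]
        omega)
      omega
    · push Not at h
      exact hG.degree_bound_of_maximal hconn hf hUv hU hi h

end SimpleGraph

/-! ### Angles on the circle, cyclic enumeration and closed walks of length three. -/

theorem Complex.exists_polar_of_norm_eq_one {b z : ℂ} (hb : ‖b‖ = 1) :
    ∃ s : ℝ, 0 ≤ s ∧ s < 2 * Real.pi ∧ z = ‖z‖ * (b * Complex.exp (s * Complex.I)) := by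
  have hb0 : b ≠ 0 := by rintro rfl; simp at hb
  have h := toIcoMod_mem_Ico Real.two_pi_pos 0 (Complex.arg (z / b))
  refine ⟨toIcoMod Real.two_pi_pos 0 (Complex.arg (z / b)), h.1, by simpa using h.2, ?_⟩
  have h1 : Complex.exp ((toIcoMod Real.two_pi_pos 0 (Complex.arg (z / b)) : ℝ) * Complex.I) =
      Complex.exp (Complex.arg (z / b) * Complex.I) := by
    rw [Complex.exp_eq_exp_iff_exists_int]
    refine ⟨-toIcoDiv Real.two_pi_pos 0 (Complex.arg (z / b)), ?_⟩
    rw [toIcoMod]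
    push_cast [zsmul_eq_mul]
    ring
  have h2 := Complex.norm_mul_exp_arg_mul_I (z / b)
  rw [norm_div, hb, div_one] at h2
  rw [h1, mul_left_comm, h2, mul_div_cancel₀ _ hb0]

theorem Complex.exp_mul_I_injective_of_lt {s t : ℝ}
    (h : Complex.exp (s * Complex.I) = Complex.exp (t * Complex.I))
    (h1 : s - t < 2 * Real.pi) (h2 : t - s < 2 * Real.pi) : s = t := by
  obtain ⟨m, hm⟩ := Complex.exp_eq_exp_iff_exists_int.1 h
  have hm' : s = t + m * (2 * Real.pi) := by
    have := congrArg Complex.im hm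
    simpa using this
  have hpi := Real.two_pi_pos
  have hm1 : m < 1 := by
    by_contra! hc
    have : (1 : ℝ) ≤ m := by exact_mod_cast hc
    nlinarith
  have hm2 : -1 < m := by
    by_contra! hc
    have : (m : ℝ) ≤ -1 := by exact_mod_cast hc
    nlinarith
  obtain rfl : m = 0 := by omega
  simpa using hm'

theorem Complex.exists_exp_sector {n : ℕ} (hn : 0 < n) {z : ℂ} (hz : ‖z‖ = 1) :
    ∃ i : ℕ, i < n ∧ ∃ t : unitInterval,
      z = Complex.exp (2 * Real.pi * Complex.I * ((i + (t : ℝ)) / n)) := by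
  obtain ⟨s, hs0, hs, hzs⟩ := Complex.exists_polar_of_norm_eq_one (b := 1) (z := z) (by simp)
  have hn' : (0 : ℝ) < n := by exact_mod_cast hn
  have hpi := Real.two_pi_pos
  have hr0 : 0 ≤ s / (2 * Real.pi) * n := by positivity
  have hr : s / (2 * Real.pi) * n < n := by
    have : s / (2 * Real.pi) < 1 := (div_lt_one hpi).2 hs
    nlinarith
  -- The sector index and the parameter in it are the integer and fractional parts of `n` times the
  -- angle in turns.
  refine ⟨⌊s / (2 * Real.pi) * n⌋₊, (Nat.floor_lt hr0).2 hr,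
    ⟨s / (2 * Real.pi) * n - ⌊s / (2 * Real.pi) * n⌋₊, ?_, ?_⟩, ?_⟩
  · exact sub_nonneg.2 (Nat.floor_le hr0)
  · have := Nat.lt_floor_add_one (s / (2 * Real.pi) * n)
    linarith
  · rw [hzs, hz]
    have hnC : (n : ℂ) ≠ 0 := by exact_mod_cast hn.ne'
    have hpC : (Real.pi : ℂ) ≠ 0 := by exact_mod_cast Real.pi_ne_zero
    simp only [Complex.ofReal_one, one_mul]
    congr 1
    push_cast
    field_simp
    ring

/-- Sorts the rays by angle. Indexing by `ℕ` makes successors easy to write; values of `c` from the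
cardinality on are arbitrary. -/
theorem Fintype.exists_strictMonoOn_enumeration {N : Type*} [Fintype N] [Nonempty N] {τ : N → ℝ}
    (hτ : Function.Injective τ) :
    ∃ c : ℕ → N, StrictMonoOn (τ ∘ c) (Set.Iio (Fintype.card N)) ∧
      ∀ u, ∃ i < Fintype.card N, c i = u := by
  classical
  let _ : LinearOrder N := LinearOrder.lift' τ hτ
  let o : Fin (Fintype.card N) ≃o N := Fintype.orderIsoFinOfCardEq N rfl
  refine ⟨fun i => if h : i < Fintype.card N then o ⟨i, h⟩ else Classical.arbitrary N, ?_, ?_⟩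
  · intro i hi j hj hij
    have hi' : i < Fintype.card N := hi
    have hj' : j < Fintype.card N := hj
    simp only [Function.comp, hi', hj', dif_pos]
    exact o.lt_iff_lt.2 (show (⟨i, hi'⟩ : Fin _) < ⟨j, hj'⟩ from hij)
  · intro u
    refine ⟨(o.symm u : Fin _), (o.symm u).2, ?_⟩
    simp

theorem exists_between_consecutive {f : ℕ → ℝ} {s : ℝ} {N : ℕ} (h0 : f 0 ≤ s) (hN : s < f N) :
    ∃ i, i + 1 ≤ N ∧ f i ≤ s ∧ s < f (i + 1) := by
  classical
  have hex : ∃ j, s < f j := ⟨N, hN⟩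
  obtain ⟨i, hi⟩ : ∃ i, Nat.find hex = i + 1 := Nat.exists_eq_succ_of_ne_zero fun h => by
    have := Nat.find_spec hex
    rw [h] at this
    exact absurd h0 (not_le.2 this)
  refine ⟨i, hi ▸ Nat.find_min' hex hN, not_lt.1 (Nat.find_min hex (by omega)), ?_⟩
  rw [← hi]
  exact Nat.find_spec hex

/-- Such a walk runs round a triangle; if two of its edges meet at `v`, the third joins their other
ends. -/
theorem SimpleGraph.Walk.adj_of_mem_edges_of_length_eq_three {V : Type*} {G : SimpleGraph V}
    {r : V} (w : G.Walk r r) (hw : w.length = 3) {v x y : V} (hxy : x ≠ y)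
    (hx : ∃ i < 3, s(v, x) = s(w.getVert i, w.getVert (i + 1)))
    (hy : ∃ i < 3, s(v, y) = s(w.getVert i, w.getVert (i + 1))) : G.Adj x y := by
  have h01 : G.Adj (w.getVert 0) (w.getVert 1) := w.adj_getVert_succ (by omega)
  have h12 : G.Adj (w.getVert 1) (w.getVert 2) := w.adj_getVert_succ (by omega)
  have h23 : G.Adj (w.getVert 2) (w.getVert 3) := w.adj_getVert_succ (by omega)
  have h3 : w.getVert 3 = w.getVert 0 := by rw [← hw]; simp
  rw [h3] at h23
  obtain ⟨i, hi, hx⟩ := hx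
  obtain ⟨j, hj, hy⟩ := hy
  interval_cases i <;> interval_cases j <;>
    simp only [Sym2.eq_iff, zero_add, Nat.reduceAdd, h3] at hx hy <;>
    grind [SimpleGraph.Adj.symm]

/-! ### Faces, boundary walks and sectors around a vertex. -/

namespace GraphDrawing

variable {V : Type*} {G : SimpleGraph V} {X : Type*} [TopologicalSpace X] {D : GraphDrawing G X}

theorem IsFace.subset_compl_image {F : Set X} (hF : D.IsFace F) : F ⊆ D.imageᶜ := by
  obtain ⟨p, -, rfl⟩ := hF
  exact connectedComponentIn_subset _ _

theorem IsFace.subset_of_isPreconnected {F S : Set X} (hF : D.IsFace F) (hS : IsPreconnected S)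
    (hSD : S ⊆ D.imageᶜ) (h : (S ∩ F).Nonempty) : S ⊆ F := by
  obtain ⟨p, -, rfl⟩ := hF
  obtain ⟨q, hqS, hqF⟩ := h
  rw [connectedComponentIn_eq hqF]
  exact hS.subset_connectedComponentIn hqS hSD

theorem IsFace.eq_of_mem {F F' : Set X} (hF : D.IsFace F) (hF' : D.IsFace F') {p : X}
    (h : p ∈ F) (h' : p ∈ F') : F = F' := by
  obtain ⟨q, -, rfl⟩ := hF
  obtain ⟨q', -, rfl⟩ := hF'
  rw [connectedComponentIn_eq h, connectedComponentIn_eq h']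

theorem arc_mem_image {u v : V} (h : G.Adj u v) {p : X} (hp : p ∈ Set.range (D.arc h)) :
    p ∈ D.image :=
  Or.inr ⟨u, v, h, hp⟩

theorem vert_mem_image (v : V) : D.vert v ∈ D.image := Or.inl ⟨v, rfl⟩

/-- The boundary of a face lies in the arcs of its boundary walk. -/
theorem IsBoundaryWalk.exists_mem_arc_of_mem_closure [T2Space X] {F : Set X} {u : V}
    {w : G.Walk u u} (hw : D.IsBoundaryWalk F w) (hlen : 0 < w.length) {y : X}
    (hy : y ∈ closure F) (hyF : y ∉ F) :
    ∃ (i : ℕ) (hi : i < w.length), y ∈ Set.range (D.arc (w.adj_getVert_succ hi)) := by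
  obtain ⟨φ, hφ, ⟨h, hh⟩, hw⟩ := hw
  have hsub : F ⊆ φ '' Metric.closedBall 0 1 := by
    intro p hp
    refine ⟨h.symm ⟨p, hp⟩, Metric.ball_subset_closedBall (h.symm ⟨p, hp⟩).2, ?_⟩
    rw [hh, h.apply_symm_apply]
  have hclosed : IsClosed (φ '' Metric.closedBall 0 1) :=
    ((isCompact_closedBall (0 : ℂ) 1).image_of_continuousOn hφ).isClosed
  obtain ⟨z, hz, rfl⟩ := closure_minimal hsub hclosed hy
  have hz1 : ‖z‖ = 1 := by
    refine le_antisymm (by simpa using hz) (not_lt.1 fun hlt => hyF ?_)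
    have hzb : z ∈ Metric.ball (0 : ℂ) 1 := by simpa using hlt
    rw [hh ⟨z, hzb⟩]
    exact (h ⟨z, hzb⟩).2
  obtain ⟨i, hi, t, rfl⟩ := Complex.exists_exp_sector hlen hz1
  exact ⟨i, hi, t, (hw i hi t).symm⟩

/-- The point `y` is off the face, hence on an arc of the boundary walk. Arcs of different edges
share only vertices, so a point that is not a vertex identifies the edge. -/
theorem IsBoundaryWalk.exists_edge_eq [T2Space X] {F : Set X} (hF : D.IsFace F) {r : V}
    {w : G.Walk r r} (hw : D.IsBoundaryWalk F w) (hlen : 0 < w.length) {u v : V} (huv : G.Adj u v)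
    {y : X} (hy : y ∈ closure F) (hyuv : y ∈ Set.range (D.arc huv)) (hyv : y ∉ Set.range D.vert) :
    ∃ i < w.length, s(u, v) = s(w.getVert i, w.getVert (i + 1)) := by
  obtain ⟨i, hi, hyi⟩ := hw.exists_mem_arc_of_mem_closure hlen hy
    fun h => hF.subset_compl_image h (arc_mem_image huv hyuv)
  refine ⟨i, hi, ?_⟩
  by_contra hne
  exact hyv (D.arc_inter_arc huv _ hne ⟨hyuv, hyi⟩)

/-- The drawing looks like a star with rays `a` in the chart `e` around the vertex `v`. -/
structure IsStarChart (D : GraphDrawing G X) (v : V) (e : OpenPartialHomeomorph X ℂ)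
    (a : G.neighborSet v → ℂ) : Prop where
  mem_source : D.vert v ∈ e.source
  apply_vert : e (D.vert v) = 0
  target_eq : e.target = Metric.ball 0 1
  injective : Function.Injective a
  norm_eq : ∀ u, ‖a u‖ = 1
  mem_arc_iff : ∀ u : G.neighborSet v, ∀ p ∈ e.source,
    p ∈ Set.range (D.arc ((G.mem_neighborSet v u).1 u.2)) ↔ ∃ t : ℝ, 0 ≤ t ∧ e p = (t : ℂ) * a u
  mem_image : ∀ p ∈ e.source, p ∈ D.image →
    p = D.vert v ∨ ∃ u : G.neighborSet v, p ∈ Set.range (D.arc ((G.mem_neighborSet v u).1 u.2))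

theorem IsTame.exists_isStarChart (h : D.IsTame) (v : V) :
    ∃ (e : OpenPartialHomeomorph X ℂ) (a : G.neighborSet v → ℂ), D.IsStarChart v e a := by
  obtain ⟨e, a, h1, h2, h3, h4, h5, h6, h7⟩ := h v
  exact ⟨e, a, h1, h2, h3, h4, h5, h6, h7⟩

namespace IsStarChart

variable {v : V} {e : OpenPartialHomeomorph X ℂ} {a : G.neighborSet v → ℂ}

theorem mem_target (h : D.IsStarChart v e a) {b : ℂ} (hb : ‖b‖ = 1) {ρ : ℝ}
    (hρ : ρ ∈ Set.Ioo (0 : ℝ) 1) (s : ℝ) :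
    (ρ : ℂ) * (b * Complex.exp (s * Complex.I)) ∈ e.target := by
  rw [h.target_eq, mem_ball_zero_iff, norm_mul, norm_mul, hb, Complex.norm_exp_ofReal_mul_I,
    Complex.norm_real, Real.norm_of_nonneg hρ.1.le, one_mul, mul_one]
  exact hρ.2

theorem notMem_image (h : D.IsStarChart v e a) {b : ℂ} (hb : ‖b‖ = 1) {ρ s : ℝ}
    (hρ : ρ ∈ Set.Ioo (0 : ℝ) 1) (hs : ∀ u, a u ≠ b * Complex.exp (s * Complex.I)) :
    e.symm (ρ * (b * Complex.exp (s * Complex.I))) ∉ D.image := by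
  have ht := h.mem_target hb hρ s
  have hn : ‖b * Complex.exp (s * Complex.I)‖ = 1 := by
    rw [norm_mul, hb, Complex.norm_exp_ofReal_mul_I, one_mul]
  have hρ0 : (ρ : ℂ) ≠ 0 := by exact_mod_cast hρ.1.ne'
  intro hp
  rcases h.mem_image _ (e.map_target ht) hp with hv | ⟨u, hu⟩
  · have h0 := h.apply_vert
    rw [← hv, e.right_inv ht] at h0
    rcases mul_eq_zero.1 h0 with h0 | h0
    · exact hρ0 h0
    · rw [h0] at hn; simp at hn
  · obtain ⟨t, ht0, hte⟩ := (h.mem_arc_iff u _ (e.map_target ht)).1 hu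
    rw [e.right_inv ht] at hte
    have h1 := congrArg norm hte
    rw [norm_mul (ρ : ℂ), norm_mul (t : ℂ), hn, h.norm_eq, Complex.norm_real, Complex.norm_real,
      Real.norm_of_nonneg hρ.1.le, Real.norm_of_nonneg ht0, mul_one, mul_one] at h1
    rw [← h1] at hte
    exact hs u (mul_left_cancel₀ hρ0 hte).symm

/-- An open sector without rays lies in one face. -/
theorem sector_subset (h : D.IsStarChart v e a) {b : ℂ} (hb : ‖b‖ = 1) {α β : ℝ}
    (hav : ∀ u, ∀ s ∈ Set.Ioo α β, a u ≠ b * Complex.exp (s * Complex.I)) {F : Set X}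
    (hF : D.IsFace F) {ρ s ρ' s' : ℝ} (hρ : ρ ∈ Set.Ioo (0 : ℝ) 1) (hs : s ∈ Set.Ioo α β)
    (hp : e.symm (ρ * (b * Complex.exp (s * Complex.I))) ∈ F) (hρ' : ρ' ∈ Set.Ioo (0 : ℝ) 1)
    (hs' : s' ∈ Set.Ioo α β) : e.symm (ρ' * (b * Complex.exp (s' * Complex.I))) ∈ F := by
  let γ : ℝ × ℝ → X := fun q => e.symm (q.1 * (b * Complex.exp (q.2 * Complex.I)))
  have hγ : ContinuousOn γ (Set.Ioo (0 : ℝ) 1 ×ˢ Set.Ioo α β) := by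
    refine e.continuousOn_symm.comp (Continuous.continuousOn ?_) fun q hq =>
      h.mem_target hb hq.1 q.2
    fun_prop
  -- In polar coordinates the sector is a rectangle, hence connected.
  have hconn : IsPreconnected (γ '' (Set.Ioo (0 : ℝ) 1 ×ˢ Set.Ioo α β)) :=
    (isPreconnected_Ioo.prod isPreconnected_Ioo).image _ hγ
  refine hF.subset_of_isPreconnected hconn ?_ ⟨_, ⟨(ρ, s), ⟨hρ, hs⟩, rfl⟩, hp⟩
    ⟨(ρ', s'), ⟨hρ', hs'⟩, rfl⟩
  rintro _ ⟨q, hq, rfl⟩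
  exact h.notMem_image hb hq.1 fun u => hav u _ hq.2

/-- The rays that bound a sector lie in the closure of its face. -/
theorem exists_mem_closure [Finite V] (h : D.IsStarChart v e a) {b : ℂ} (hb : ‖b‖ = 1) {α β : ℝ}
    (hαβ : α < β) {F : Set X}
    (hF : ∀ ρ ∈ Set.Ioo (0 : ℝ) 1, ∀ s ∈ Set.Ioo α β,
      e.symm (ρ * (b * Complex.exp (s * Complex.I))) ∈ F) {γ : ℝ} (hγ : γ ∈ Set.Icc α β)
    {u : G.neighborSet v} (hu : a u = b * Complex.exp (γ * Complex.I)) :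
    ∃ y ∈ closure F, y ∈ Set.range (D.arc ((G.mem_neighborSet v u).1 u.2)) ∧
      y ∉ Set.range D.vert := by
  let δ : ℝ → X := fun ρ => e.symm (ρ * (b * Complex.exp (γ * Complex.I)))
  have hinj : Set.InjOn δ (Set.Ioo 0 1) := by
    intro x hx y hy hxy
    have := e.symm.injOn (h.mem_target hb hx γ) (h.mem_target hb hy γ) hxy
    rw [← hu] at this
    have hne : a u ≠ 0 := fun h0 => by simpa [h0] using h.norm_eq u
    exact_mod_cast mul_right_cancel₀ hne this
  -- The ray has infinitely many points and only finitely many are vertices; `exists_edge_eq` needs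
  -- a point that is not a vertex.
  have hinf : (δ '' Set.Ioo 0 1).Infinite := (Set.Ioo_infinite one_pos).image hinj
  obtain ⟨_, ⟨ρ, hρ, rfl⟩, hy⟩ := hinf.exists_notMem_finite (Set.finite_range D.vert)
  have ht := h.mem_target hb hρ γ
  refine ⟨_, ?_, ?_, hy⟩
  · have hc : ContinuousAt (fun s : ℝ => e.symm (ρ * (b * Complex.exp (s * Complex.I)))) γ := by
      refine ContinuousAt.comp (f := fun s : ℝ => (ρ * (b * Complex.exp (s * Complex.I)) : ℂ))
        (e.continuousAt_symm ht) (Continuous.continuousAt ?_)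
      fun_prop
    refine hc.continuousWithinAt.mem_closure (s := Set.Ioo α β) ?_ fun s hs => hF ρ hρ s hs
    rwa [closure_Ioo hαβ.ne]
  · rw [h.mem_arc_iff u _ (e.map_target ht)]
    exact ⟨ρ, hρ.1.le, by rw [e.right_inv ht, hu]⟩

/-- The two rays that bound a sector in a triangular face belong to adjacent vertices. -/
theorem adj_of_sector [T2Space X] [Finite V] (h : D.IsStarChart v e a) {b : ℂ} (hb : ‖b‖ = 1)
    {u u' : G.neighborSet v} {α β : ℝ} (hα : a u = b * Complex.exp (α * Complex.I))
    (hβ : a u' = b * Complex.exp (β * Complex.I)) (hne : u ≠ u')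
    (hav : ∀ u, ∀ s ∈ Set.Ioo α β, a u ≠ b * Complex.exp (s * Complex.I)) {F : Set X}
    (hF : D.IsTriangularFace F) {ρ s : ℝ} (hρ : ρ ∈ Set.Ioo (0 : ℝ) 1) (hs : s ∈ Set.Ioo α β)
    (hp : e.symm (ρ * (b * Complex.exp (s * Complex.I))) ∈ F) : G.Adj u u' := by
  obtain ⟨hF, r, w, hw3, hw⟩ := hF
  have hαβ : α < β := hs.1.trans hs.2
  have hsec : ∀ ρ ∈ Set.Ioo (0 : ℝ) 1, ∀ s ∈ Set.Ioo α β,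
      e.symm (ρ * (b * Complex.exp (s * Complex.I))) ∈ F := fun ρ' hρ' s' hs' =>
    h.sector_subset hb hav hF hρ hs hp hρ' hs'
  obtain ⟨y, hyF, hya, hyv⟩ := h.exists_mem_closure hb hαβ hsec (Set.left_mem_Icc.2 hαβ.le) hα
  obtain ⟨y', hyF', hya', hyv'⟩ :=
    h.exists_mem_closure hb hαβ hsec (Set.right_mem_Icc.2 hαβ.le) hβ
  refine w.adj_of_mem_edges_of_length_eq_three hw3 (v := v) (Subtype.coe_injective.ne hne) ?_ ?_
  · simpa only [hw3] using hw.exists_edge_eq hF (by omega) _ hyF hya hyv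
  · simpa only [hw3] using hw.exists_edge_eq hF (by omega) _ hyF' hya' hyv'

theorem apply_ne_zero (h : D.IsStarChart v e a) {q : X} (hq : q ∈ e.source) (hqD : q ∉ D.image) :
    e q ≠ 0 := by
  intro h0
  apply hqD
  rw [e.injOn hq h.mem_source (h0.trans h.apply_vert.symm)]
  exact vert_mem_image v

theorem apply_ne_ray (h : D.IsStarChart v e a) {q : X} (hq : q ∈ e.source) (hqD : q ∉ D.image)
    (u : G.neighborSet v) {t : ℝ} (ht : 0 ≤ t) : e q ≠ t * a u := fun hqu =>
  hqD (arc_mem_image _ ((h.mem_arc_iff u q hq).2 ⟨t, ht, hqu⟩))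

/-- The neighbours of `v` in the order of their rays, starting from the direction of a point `q`
off the graph, together with a point `p i` of the sector between the `i`-th and the next ray. -/
theorem exists_rotation [T2Space X] [Finite V] [Fintype (G.neighborSet v)]
    [Nonempty (G.neighborSet v)] (h : D.IsStarChart v e a) {q : X}
    (hq : q ∈ e.source) (hqD : q ∉ D.image) :
    ∃ (c : ℕ → G.neighborSet v) (p : ℕ → X), Set.InjOn c (Set.Iio (G.degree v)) ∧
      (∀ i, i + 1 < G.degree v → p i ∈ e.source ∧ p i ∉ D.image) ∧
      (∀ i, i + 1 < G.degree v → ∀ F, D.IsTriangularFace F → p i ∈ F →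
        G.Adj (c i) (c (i + 1))) ∧
      ∀ F ∈ D.triangularFacesAt v, q ∈ F ∨ ∃ i, i + 1 < G.degree v ∧ p i ∈ F := by
  have hq0 := h.apply_ne_zero hq hqD
  have hq0' : ((‖e q‖ : ℝ) : ℂ) ≠ 0 := by simpa using hq0
  -- Angles are measured from the direction `b` of `q`, which is not a ray, so every ray has its
  -- angle strictly between `0` and `2π`.
  obtain ⟨b, hbq⟩ : ∃ b : ℂ, e q = ‖e q‖ * b := ⟨e q / ‖e q‖, by field_simp⟩
  have hb : ‖b‖ = 1 := by
    have := congrArg norm hbq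
    rw [norm_mul, Complex.norm_real, norm_norm] at this
    exact (mul_eq_left₀ (norm_ne_zero_iff.2 hq0)).1 this.symm
  have hab : ∀ u, a u ≠ b := fun u hu =>
    h.apply_ne_ray hq hqD u (norm_nonneg (e q)) (by rw [hu]; exact hbq)
  have hpolar : ∀ u, ∃ s : ℝ, 0 < s ∧ s < 2 * Real.pi ∧ a u = b * Complex.exp (s * Complex.I) := by
    intro u
    obtain ⟨s, hs0, hs, hus⟩ := Complex.exists_polar_of_norm_eq_one (z := a u) hb
    rw [h.norm_eq, Complex.ofReal_one, one_mul] at hus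
    refine ⟨s, lt_of_le_of_ne hs0 ?_, hs, hus⟩
    rintro rfl
    exact hab u (by simpa using hus)
  choose τ hτ0 hτ hτa using hpolar
  have hτinj : Function.Injective τ := fun u u' huu' => h.injective (by rw [hτa, hτa, huu'])
  have hnorm : ∀ p ∈ e.source, p ∉ D.image → ‖e p‖ ∈ Set.Ioo (0 : ℝ) 1 := by
    intro p hp hpD
    have := e.map_source hp
    rw [h.target_eq, mem_ball_zero_iff] at this
    exact ⟨norm_pos_iff.2 (h.apply_ne_zero hp hpD), this⟩
  obtain ⟨c, hcmono, hcsurj⟩ := Fintype.exists_strictMonoOn_enumeration hτinj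
  rw [G.card_neighborSet_eq_degree] at hcmono hcsurj
  have hd : 0 < G.degree v := by
    rw [← G.card_neighborSet_eq_degree]; exact Fintype.card_pos
  have hcle : ∀ {i j : ℕ}, j < G.degree v → i ≤ j → τ (c i) ≤ τ (c j) := fun {i j} hj hij =>
    hcmono.monotoneOn (lt_of_le_of_lt hij hj) hj hij
  have hav : ∀ i, i + 1 < G.degree v → ∀ u, ∀ s ∈ Set.Ioo (τ (c i)) (τ (c (i + 1))),
      a u ≠ b * Complex.exp (s * Complex.I) := by
    intro i hi u s hs hus
    have hb0 : b ≠ 0 := by rintro rfl; simp at hb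
    rw [hτa u] at hus
    have h0 := hτ0 (c i)
    have h1 := hτ (c (i + 1))
    have hus' := Complex.exp_mul_I_injective_of_lt (mul_left_cancel₀ hb0 hus)
      (by linarith [hτ u, hs.1]) (by linarith [hτ0 u, hs.2])
    obtain ⟨j, hj, rfl⟩ := hcsurj u
    rcases le_or_gt j i with hji | hji
    · linarith [hcle (by omega : i < G.degree v) hji, hs.1]
    · linarith [hcle hj (Nat.succ_le_of_lt hji), hs.2]
  -- The sector through the cut, from the last ray (turned back by `2π`) to the first; it contains
  -- the angle `0` of `q`.
  have hav' : ∀ u, ∀ s ∈ Set.Ioo (τ (c (G.degree v - 1)) - 2 * Real.pi) (τ (c 0)),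
      a u ≠ b * Complex.exp (s * Complex.I) := by
    intro u s hs hus
    have hb0 : b ≠ 0 := by rintro rfl; simp at hb
    rw [hτa u] at hus
    obtain ⟨j, hj, rfl⟩ := hcsurj u
    have h0 := hcle hj (Nat.zero_le j)
    have h1 := hcle (by omega : G.degree v - 1 < G.degree v) (by omega : j ≤ G.degree v - 1)
    have hus' := Complex.exp_mul_I_injective_of_lt (mul_left_cancel₀ hb0 hus)
      (by linarith [hs.1]) (by linarith [hs.2, Real.two_pi_pos])
    linarith [hs.2]
  have hhalf : (1 / 2 : ℝ) ∈ Set.Ioo (0 : ℝ) 1 := by constructor <;> norm_num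
  have hmid : ∀ i, i + 1 < G.degree v →
      (τ (c i) + τ (c (i + 1))) / 2 ∈ Set.Ioo (τ (c i)) (τ (c (i + 1))) := by
    intro i hi
    have : τ (c i) < τ (c (i + 1)) :=
      hcmono (lt_of_le_of_lt (Nat.le_succ i) hi) hi (Nat.lt_succ_self i)
    constructor <;> linarith
  refine ⟨c, fun i => e.symm ((1 / 2 : ℝ) *
    (b * Complex.exp (((τ (c i) + τ (c (i + 1))) / 2 : ℝ) * Complex.I))), ?_, ?_, ?_, ?_⟩
  · intro i hi j hj hij
    exact hcmono.injOn hi hj (congrArg τ hij)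
  · intro i hi
    exact ⟨e.map_target (h.mem_target hb hhalf _),
      h.notMem_image hb hhalf fun u => hav i hi u _ (hmid i hi)⟩
  · intro i hi F hF hpF
    refine h.adj_of_sector hb (hτa _) (hτa _) (fun hc => ?_) (hav i hi) hF hhalf (hmid i hi) hpF
    have := hmid i hi
    rw [← hc] at this
    exact lt_irrefl _ (this.1.trans this.2)
  · rintro F ⟨⟨hF, -⟩, hvF⟩
    obtain ⟨p, hpe, hpF⟩ := mem_closure_iff.1 hvF _ e.open_source h.mem_source
    have hpD := hF.subset_compl_image hpF
    obtain ⟨s, hs0, hs, hps⟩ := Complex.exists_polar_of_norm_eq_one (z := e p) hb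
    have hsτ : ∀ u, s ≠ τ u := by
      rintro u rfl
      rw [← hτa] at hps
      exact h.apply_ne_ray hpe hpD u (norm_nonneg _) hps
    have hpF' : e.symm (‖e p‖ * (b * Complex.exp (s * Complex.I))) ∈ F := by
      rwa [← hps, e.left_inv hpe]
    have hq' : e.symm (‖e q‖ * (b * Complex.exp ((0 : ℝ) * Complex.I))) = q := by
      rw [Complex.ofReal_zero, zero_mul, Complex.exp_zero, mul_one, ← hbq, e.left_inv hq]
    have hwrap : (0 : ℝ) ∈ Set.Ioo (τ (c (G.degree v - 1)) - 2 * Real.pi) (τ (c 0)) :=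
      ⟨by linarith [hτ (c (G.degree v - 1))], hτ0 _⟩
    rcases lt_or_ge s (τ (c 0)) with hlo | hlo
    · left
      rw [← hq']
      exact h.sector_subset hb hav' hF (hnorm p hpe hpD) ⟨by linarith [hwrap.1], hlo⟩ hpF'
        (hnorm q hq hqD) hwrap
    rcases lt_or_ge s (τ (c (G.degree v - 1))) with hhi | hhi
    · right
      obtain ⟨i, hi, his, his'⟩ := exists_between_consecutive (f := τ ∘ c) hlo hhi
      refine ⟨i, by omega, ?_⟩
      exact h.sector_subset hb (hav i (by omega)) hF (hnorm p hpe hpD)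
        ⟨lt_of_le_of_ne his (hsτ _).symm, his'⟩ hpF' hhalf (hmid i (by omega))
    · left
      rw [← hq']
      -- A point beyond the last ray lies in the sector of `q` once its angle is lowered by `2π`.
      have hexp : Complex.exp ((s - 2 * Real.pi : ℝ) * Complex.I) =
          Complex.exp (s * Complex.I) := by
        rw [Complex.exp_eq_exp_iff_exists_int]
        refine ⟨-1, ?_⟩
        push_cast
        ring
      rw [← hexp] at hpF'
      exact h.sector_subset hb hav' hF (hnorm p hpe hpD)
        ⟨by linarith [lt_of_le_of_ne hhi (hsτ _).symm], by linarith [hτ0 (c 0)]⟩ hpF'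
        (hnorm q hq hqD) hwrap

end IsStarChart

end GraphDrawing

/-! ### Disjoint edges from triangular faces and the final count. -/

/-- Disjoint edges between consecutive terms of a sequence of distinct vertices. -/
theorem SimpleGraph.exists_isPairing_consecutive {V : Type*} {G : SimpleGraph V} {c : ℕ → V}
    {d r : ℕ} (hc : Set.InjOn c (Set.Iio d)) {I : Finset ℕ} (hI : ∀ i ∈ I, i + 1 < d)
    (hr : ∀ i ∈ I, i % 2 = r) (hadj : ∀ i ∈ I, G.Adj (c i) (c (i + 1))) :
    ∃ U f, G.IsPairing U f ∧ U.card = 2 * I.card ∧ ∀ x ∈ U, ∃ i, x = c i := by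
  classical
  obtain ⟨⟨f, hf⟩, hcard⟩ := (IsPairing.empty G id).exists_union I c (fun i => c (i + 1))
    (fun i hi j hj h => hc ((Nat.lt_succ_self i).trans (hI i hi))
      ((Nat.lt_succ_self j).trans (hI j hj)) h)
    (fun i hi j hj h => Nat.succ_injective (hc (hI i hi) (hI j hj) h))
    -- Indices of equal parity never differ by one, so consecutive pairs cannot overlap.
    (fun i hi j hj h => by
      have := hc ((Nat.lt_succ_self i).trans (hI i hi)) (hI j hj) h
      have := hr i hi
      have := hr j hj
      omega)
    (by simp) (by simp) hadj
  refine ⟨_, f, hf, by simpa using hcard, fun x hx => ?_⟩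
  simp only [Finset.mem_union, Finset.notMem_empty, false_or, Finset.mem_image] at hx
  rcases hx with ⟨i, -, rfl⟩ | ⟨i, -, rfl⟩
  · exact ⟨i, rfl⟩
  · exact ⟨i + 1, rfl⟩

theorem Finset.exists_subset_mod_two (I : Finset ℕ) {m : ℕ} (hm : m ≤ (I.card + 1) / 2) :
    ∃ J ⊆ I, J.card = m ∧ ∃ r, ∀ i ∈ J, i % 2 = r := by
  have h := Finset.card_filter_add_card_filter_not (s := I) (fun i => i % 2 = 0)
  rcases le_or_gt m (I.filter fun i => i % 2 = 0).card with h0 | h0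
  · obtain ⟨J, hJ, hJm⟩ := Finset.exists_subset_card_eq h0
    exact ⟨J, hJ.trans (Finset.filter_subset _ _), hJm, 0,
      fun i hi => (Finset.mem_filter.1 (hJ hi)).2⟩
  · obtain ⟨J, hJ, hJm⟩ := Finset.exists_subset_card_eq
      (s := I.filter fun i => ¬ i % 2 = 0) (n := m) (by omega)
    exact ⟨J, hJ.trans (Finset.filter_subset _ _), hJm, 1,
      fun i hi => by have := (Finset.mem_filter.1 (hJ hi)).2; omega⟩

theorem mainTheorem8 {V : Type*} [Fintype V] (G : SimpleGraph V) [DecidableRel G.Adj]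
    {X : Type*} [TopologicalSpace X] [T2Space X] [CompactSpace X] [ConnectedSpace X]
    [ChartedSpace (EuclideanSpace ℝ (Fin 2)) X]
    (n k : ℕ) (hk : 1 ≤ k) (hconn : G.Connected) (hG : G.IsNKGraph n k)
    (E : CellularEmbedding G X) (v : V) (x : ℕ)
    (hx : (E.triangularFacesAt v).encard = (x : ℕ∞)) :
    (x ≤ 2 * k - 2 → n + k + 1 + ⌈(x : ℚ) / 2⌉₊ ≤ G.degree v) ∧
      (2 * k - 1 ≤ x → n + 2 * k + 1 ≤ G.degree v) := by
  classical
  have hceil : ∀ m : ℕ, x ≤ 2 * m → ⌈(x : ℚ) / 2⌉₊ ≤ m := fun m hm => by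
    rw [Nat.ceil_le, div_le_iff₀ two_pos, mul_comm]
    exact_mod_cast hm
  -- Both cases of the bound follow: `m = k` gives the largest value claimed, and `x ≤ 2 * m` gives
  -- `⌈x / 2⌉ ≤ m`, with `m ≥ k` once `x ≥ 2 * k - 1`.
  suffices h : ∃ m, (m = k ∨ x ≤ 2 * m) ∧ n + k + m + 1 ≤ G.degree v by
    obtain ⟨m, hm, hd⟩ := h
    constructor
    · intro hxk
      have h1 := hceil (k - 1) (by omega)
      rcases hm with rfl | hm
      · omega
      · have h2 := hceil m hm
        omega
    · intro hxk
      omega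
  have hfin : (E.triangularFacesAt v).Finite := Set.finite_of_encard_eq_coe hx
  have hd0 : n + k + 0 + 1 ≤ G.degree v :=
    hG.degree_bound hconn (SimpleGraph.IsPairing.empty G id) (by simp) (by simp) (Nat.zero_le k)
  rcases (E.triangularFacesAt v).eq_empty_or_nonempty with h0 | ⟨F₀, hF₀⟩
  · have hx0 : x = 0 := by
      rw [h0, Set.encard_empty] at hx
      exact_mod_cast hx.symm
    exact ⟨0, Or.inr (by omega), hd0⟩
  have : Nonempty (G.neighborSet v) := by
    rw [← Fintype.card_pos_iff, G.card_neighborSet_eq_degree]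
    omega
  obtain ⟨e, a, he⟩ := E.tame.exists_isStarChart v
  have hbound : ∀ (c : ℕ → G.neighborSet v) (J : Finset ℕ) (r : ℕ),
      Set.InjOn c (Set.Iio (G.degree v)) → (∀ i ∈ J, i + 1 < G.degree v) →
      (∀ i ∈ J, i % 2 = r) → (∀ i ∈ J, G.Adj (c i) (c (i + 1))) → J.card ≤ k →
      n + k + J.card + 1 ≤ G.degree v := by
    intro c J r hc hJ hr hadj hJk
    obtain ⟨U, f, hf, hU, hUc⟩ := SimpleGraph.exists_isPairing_consecutive
      (c := fun i => (c i : V)) (Subtype.val_injective.comp_injOn hc) hJ hr hadj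
    refine hG.degree_bound hconn hf (fun y hy => ?_) hU hJk
    obtain ⟨i, rfl⟩ := hUc y hy
    exact (c i).2
  -- If some sector is not triangular, the rotation is cut there, so no triangular face is lost at
  -- the cut.
  by_cases hq : ∃ q ∈ e.source, q ∉ E.image ∧ ∀ F ∈ E.triangularFacesAt v, q ∉ F
  · obtain ⟨q, hqe, hqE, hqF⟩ := hq
    obtain ⟨c, p, hc, -, hadj, hF⟩ := he.exists_rotation hqe hqE
    have hF' : ∀ F ∈ E.triangularFacesAt v, ∃ i, i + 1 < G.degree v ∧ p i ∈ F := fun F hF₁ =>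
      (hF F hF₁).resolve_left (hqF F hF₁)
    choose! ι hι hpι using hF'
    -- Distinct faces are disjoint, so they cannot share a point `p i`.
    have hinj : Set.InjOn ι (E.triangularFacesAt v) := fun F hF₁ F' hF₂ h =>
      hF₁.1.1.eq_of_mem hF₂.1.1 (hpι F hF₁) (h ▸ hpι F' hF₂)
    have hcard : (hfin.toFinset.image ι).card = x := by
      rw [Finset.card_image_of_injOn (by simpa using hinj), ← Set.ncard_eq_toFinset_card _ hfin,
        Set.ncard, hx, ENat.toNat_natCast]
    obtain ⟨J, hJ, hJm, r, hr⟩ := (hfin.toFinset.image ι).exists_subset_mod_two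
      (m := min k ((x + 1) / 2)) (by rw [hcard]; exact min_le_right _ _)
    have hJ' : ∀ i ∈ J, ∃ F ∈ E.triangularFacesAt v, ι F = i := fun i hi => by
      simpa using hJ hi
    have hJd : ∀ i ∈ J, i + 1 < G.degree v := fun i hi => by
      obtain ⟨F, hF₁, rfl⟩ := hJ' i hi
      exact hι F hF₁
    have := hbound c J r hc hJd hr (fun i hi => by
      obtain ⟨F, hF₁, rfl⟩ := hJ' i hi
      exact hadj _ (hJd _ hi) F hF₁.1 (hpι F hF₁)) (by rw [hJm]; exact min_le_left _ _)
    exact ⟨J.card, by omega, this⟩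
  -- Here all sectors are triangular, so the position of the cut is irrelevant and the whole
  -- sequence of neighbours is a path.
  · push Not at hq
    obtain ⟨q, hqe, hqF⟩ := mem_closure_iff.1 hF₀.2 _ e.open_source he.mem_source
    obtain ⟨c, p, hc, hp, hadj, -⟩ :=
      he.exists_rotation hqe (hF₀.1.1.subset_compl_image hqF)
    have hadj' : ∀ i, i + 1 < G.degree v → G.Adj (c i) (c (i + 1)) := fun i hi => by
      obtain ⟨F, hF, hpF⟩ := hq (p i) (hp i hi).1 (hp i hi).2
      exact hadj i hi F hF.1 hpF
    have hJ : ∀ i ∈ (Finset.range (min k (G.degree v / 2))).image (2 * ·),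
        i + 1 < G.degree v ∧ i % 2 = 0 := fun i hi => by
      obtain ⟨j, hj, rfl⟩ := Finset.mem_image.1 hi
      rw [Finset.mem_range] at hj
      omega
    have hJcard : ((Finset.range (min k (G.degree v / 2))).image (2 * ·)).card =
        min k (G.degree v / 2) := by
      rw [Finset.card_image_of_injective _ fun i j h => by simpa using h, Finset.card_range]
    have := hbound c _ 0 hc (fun i hi => (hJ i hi).1) (fun i hi => (hJ i hi).2)
      (fun i hi => hadj' i (hJ i hi).1) (by rw [hJcard]; exact min_le_left _ _)
    rw [hJcard] at this
    -- If `d / 2 < k`, the bound would read `n + k + d / 2 + 1 ≤ d`, which forces `d / 2 ≥ k`; hence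
    -- the minimum is `k`.
    exact ⟨k, Or.inl rfl, by omega⟩
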